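/- Let $G$ be a finite, simple, undirected, connected graph on $n$ vertices that is 2-degenerate, meaning that every non-empty subgraph of $G$ has a vertex of degree at most $2$ in that subgraph. If $G$ is not a triangle (that is, not isomorphic to $K_3$), then the edge set of $G$ can be partitioned into the edge sets of at most $\lfloor n/2 \rfloor$ paths of $G$, where a path is a walk without repeated vertices. -/

import Mathlib

namespace SimpleGraph

/-- A graph is `k`-degenerate if every (nonempty) subgraph, induced or not, has a vertex whose
degree in that subgraph is at most `k`. -/
def IsDegenerate {V : Type*} (G : SimpleGraph V) (k : ℕ) : Prop :=
  ∀ H : G.Subgraph, H.verts.Nonempty → ∃ v ∈ H.verts, (H.neighborSet v).encard ≤ k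

/-- A path decomposition of `G`: a partition of the edge set of `G` into edge sets of paths of `G`.
The parts are pairwise disjoint, they cover the edge set, and each of them is the edge set of
a path with at least one edge (so no part is empty). -/
structure IsPathDecomposition {V : Type*} (G : SimpleGraph V) (D : Finset (Set (Sym2 V))) :
    Prop where
  isPath : ∀ s ∈ D, ∃ (u v : V) (p : G.Walk u v), p.IsPath ∧ 0 < p.length ∧ p.edgeSet = s
  pairwiseDisjoint : (D : Set (Set (Sym2 V))).PairwiseDisjoint id
  cover : ⋃₀ (D : Set (Set (Sym2 V))) = G.edgeSet

end SimpleGraph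

/-! Allowing triangles next to paths makes connectivity unnecessary: every 2-degenerate graph on a
vertex set `W`, connected or not, splits into at most `|W|/2` paths and triangles
(`TwoDegenerateOn.exists_dec`, by induction on `|W| + |E|`).

Deleting two vertices pays for one new element (`TwoDegenerateOn.exists_dec_sub`). If two vertices
of degree at most 2 are adjacent, the edges at them form that element. Otherwise degeneracy, applied
to the vertices of degree at least 3, yields such a vertex `z` with a neighbor `v` of degree at most
2. If `z` has two such neighbors, delete these. If not, `z` has degree 3 with neighbors `a`, `b`,
`v`. When `v` is adjacent to `a` or `b`, or when `a` has even degree, delete `z` and `v`; a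
remaining edge that fits into no new path is attached to an old path, which exists by parity or is
cut out of an element. When `a` has odd degree, replace `zb`, `zv` by `vb`, apply induction, and
undo this by `Dec.subdivide_by_leaf`.

In a connected graph other than `K₃`, each triangle meets another element, and the two can be
redrawn as two paths (`Dec.exists_fewer_triangles`). -/

namespace SimpleGraph.PathDecomposition

/-! ### Paths as lists, their edge multisets and degrees -/

section

variable {V : Type*}

/-- The multiset of edges joining consecutive vertices of a list. -/
def listEdges : List V → Multiset (Sym2 V)
  | [] => 0
  | [_] => 0
  | a :: b :: l => s(a, b) ::ₘ listEdges (b :: l)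

@[simp] theorem listEdges_nil : listEdges ([] : List V) = 0 := rfl

@[simp] theorem listEdges_singleton (a : V) : listEdges [a] = 0 := rfl

@[simp] theorem listEdges_cons_cons (a b : V) (l : List V) :
    listEdges (a :: b :: l) = s(a, b) ::ₘ listEdges (b :: l) := rfl

theorem listEdges_append_cons (l₁ l₂ : List V) (x : V) :
    listEdges (l₁ ++ x :: l₂) = listEdges (l₁ ++ [x]) + listEdges (x :: l₂) := by
  induction l₁ with
  | nil => simp
  | cons a l ih =>
    cases l with
    | nil => simp
    | cons b l => simpa using ih

theorem listEdges_append_pair (l₁ l₂ : List V) (x y : V) :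
    listEdges (l₁ ++ x :: y :: l₂) =
      listEdges (l₁ ++ [x]) + {s(x, y)} + listEdges (y :: l₂) := by
  rw [listEdges_append_cons, listEdges_cons_cons, ← Multiset.singleton_add, add_assoc]

theorem listEdges_reverse (l : List V) : listEdges l.reverse = listEdges l := by
  induction l with
  | nil => simp
  | cons a l ih =>
    cases l with
    | nil => simp
    | cons b l =>
      rw [List.reverse_cons] at ih
      simp only [List.reverse_cons, List.append_assoc, List.cons_append, List.nil_append]
      rw [listEdges_append_cons, ih, listEdges_cons_cons, listEdges_cons_cons,
        listEdges_singleton, Sym2.eq_swap, add_comm, Multiset.cons_add, zero_add]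

theorem exists_append_of_mem_listEdges {l : List V} {e : Sym2 V} (h : e ∈ listEdges l) :
    ∃ A p q B, l = A ++ p :: q :: B ∧ e = s(p, q) := by
  induction l with
  | nil => simp at h
  | cons a l ih =>
    cases l with
    | nil => simp at h
    | cons b l =>
      rw [listEdges_cons_cons, Multiset.mem_cons] at h
      rcases h with h | h
      · exact ⟨[], a, b, l, rfl, h⟩
      · obtain ⟨A, p, q, B, hl, he⟩ := ih h
        exact ⟨a :: A, p, q, B, by simp [hl], he⟩

theorem mem_of_mem_listEdges {l : List V} {e : Sym2 V} {v : V} (h : e ∈ listEdges l)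
    (hv : v ∈ e) : v ∈ l := by
  obtain ⟨A, p, q, B, rfl, rfl⟩ := exists_append_of_mem_listEdges h
  simp at hv ⊢
  tauto

theorem exists_mem_listEdges_cons {l : List V} {a v : V} (h : v ∈ l) :
    ∃ e ∈ listEdges (a :: l), v ∈ e := by
  induction l generalizing a with
  | nil => simp at h
  | cons b l ih =>
    rcases List.mem_cons.1 h with rfl | h
    · exact ⟨s(a, v), by simp, by simp⟩
    · obtain ⟨e, he, hv⟩ := ih (a := b) h
      exact ⟨e, by simp [he], hv⟩

theorem nodup_listEdges {l : List V} (h : l.Nodup) : (listEdges l).Nodup := by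
  induction l with
  | nil => simp
  | cons a l ih =>
    cases l with
    | nil => simp
    | cons b l =>
      rw [listEdges_cons_cons, Multiset.nodup_cons]
      refine ⟨fun hm => ?_, ih (List.nodup_cons.1 h).2⟩
      exact (List.nodup_cons.1 h).1 (mem_of_mem_listEdges hm (by simp))

/-- An edge of a path may be subdivided by a new vertex. -/
theorem exists_subdivide {l : List V} {p q z : V} (hl : l.Nodup) (h : s(p, q) ∈ listEdges l)
    (hz : z ∉ l) : ∃ l' : List V, l'.Nodup ∧
      listEdges l' + {s(p, q)} = listEdges l + ({s(z, p)} + {s(z, q)}) := by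
  obtain ⟨A, p', q', B, rfl, he⟩ := exists_append_of_mem_listEdges h
  refine ⟨A ++ p' :: z :: q' :: B, ?_, ?_⟩
  · simp [List.nodup_append] at hl hz ⊢
    grind
  · have h1 : ({s(p', z)} + {s(z, q')} : Multiset (Sym2 V)) = {s(z, p)} + {s(z, q)} := by
      rw [Sym2.eq_iff] at he
      rcases he with ⟨rfl, rfl⟩ | ⟨rfl, rfl⟩
      · rw [Sym2.eq_swap]
      · rw [Sym2.eq_swap, add_comm]
    rw [listEdges_append_pair, listEdges_append_pair, listEdges_cons_cons, he, ← h1,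
      ← Multiset.singleton_add]
    abel

/-- The edges of the triangle with the given corners. -/
def triEdges (x y z : V) : Multiset (Sym2 V) := {s(x, y)} + {s(y, z)} + {s(z, x)}

theorem triEdges_rotate (x y z : V) : triEdges x y z = triEdges y z x := by
  unfold triEdges; abel

theorem triEdges_swap (x y z : V) : triEdges x y z = triEdges x z y := by
  unfold triEdges
  rw [Sym2.eq_swap (a := x) (b := z), Sym2.eq_swap (a := z) (b := y),
    Sym2.eq_swap (a := y) (b := x)]
  abel

/-- `Dec E k t` says that `E` is the sum of the edge multisets of `k` paths and triangles, `t` of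
which are triangles. Paths may be without edges. -/
inductive Dec : Multiset (Sym2 V) → ℕ → ℕ → Prop
  | zero : Dec 0 0 0
  | path {E : Multiset (Sym2 V)} {k t : ℕ} (l : List V) (hl : l.Nodup) (h : Dec E k t) :
      Dec (listEdges l + E) (k + 1) t
  | tri {E : Multiset (Sym2 V)} {k t : ℕ} {x y z : V} (hxy : x ≠ y) (hyz : y ≠ z) (hzx : z ≠ x)
      (h : Dec E k t) : Dec (triEdges x y z + E) (k + 1) (t + 1)

variable [DecidableEq V]

/-- The number of edges of `E` that contain `v`. -/
def deg (v : V) (E : Multiset (Sym2 V)) : ℕ := E.countP (v ∈ ·)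

@[simp] theorem deg_zero (v : V) : deg v 0 = 0 := by simp [deg]

@[simp] theorem deg_add (v : V) (E F : Multiset (Sym2 V)) : deg v (E + F) = deg v E + deg v F := by
  simp [deg]

@[simp] theorem deg_cons (v a b : V) (E : Multiset (Sym2 V)) :
    deg v (s(a, b) ::ₘ E) = (if v = a ∨ v = b then 1 else 0) + deg v E := by
  simp [deg, Multiset.countP_cons, add_comm]

@[simp] theorem deg_singleton (v a b : V) :
    deg v {s(a, b)} = if v = a ∨ v = b then 1 else 0 := by
  rw [← Multiset.cons_zero, deg_cons, deg_zero, add_zero]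

theorem deg_eq_zero {v : V} {E : Multiset (Sym2 V)} : deg v E = 0 ↔ ∀ e ∈ E, v ∉ e := by
  simp [deg, Multiset.countP_eq_zero]

theorem deg_pos {v : V} {E : Multiset (Sym2 V)} : 0 < deg v E ↔ ∃ e ∈ E, v ∈ e := by
  simp [deg, Multiset.countP_pos]

theorem deg_listEdges_of_notMem {l : List V} {v : V} (h : v ∉ l) : deg v (listEdges l) = 0 :=
  deg_eq_zero.2 fun _ he hv => h (mem_of_mem_listEdges he hv)

theorem deg_listEdges_cons_pos {l : List V} {a v : V} (h : v ∈ l) :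
    0 < deg v (listEdges (a :: l)) :=
  deg_pos.2 (exists_mem_listEdges_cons h)

theorem deg_listEdges_cons_self {l : List V} {v : V} (h : v ∉ l) (hl : l ≠ []) :
    deg v (listEdges (v :: l)) = 1 := by
  cases l with
  | nil => exact absurd rfl hl
  | cons b l => simp [deg_listEdges_of_notMem h]

/-- An inner vertex of a path has degree 2 in it, so odd degree forces `v` to be an end. -/
theorem exists_end_of_odd {l : List V} {v : V} (hl : l.Nodup) (h : Odd (deg v (listEdges l))) :
    ∃ l', l' ≠ [] ∧ (v :: l').Nodup ∧ listEdges (v :: l') = listEdges l ∧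
      (l = v :: l' ∨ l.reverse = v :: l') := by
  by_cases hv : v ∈ l
  swap
  · simp [deg_listEdges_of_notMem hv] at h
  obtain ⟨A, B, rfl⟩ := List.append_of_mem hv
  have hA : v ∉ A := by
    intro hA; have := List.nodup_append.1 hl; exact this.2.2 v hA v (by simp) rfl
  have hB : v ∉ B := by
    have := (List.nodup_append.1 hl).2.1; exact (List.nodup_cons.1 this).1
  by_cases hA0 : A = []
  · subst hA0
    refine ⟨B, ?_, hl, rfl, Or.inl rfl⟩
    rintro rfl; simp at h
  by_cases hB0 : B = []
  · subst hB0
    have hr : (A ++ [v]).reverse = v :: A.reverse := by simp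
    refine ⟨A.reverse, by simpa using hA0, ?_, ?_, Or.inr hr⟩
    · rw [← hr]; exact List.nodup_reverse.2 hl
    · rw [← hr, listEdges_reverse]
  rw [listEdges_append_cons, deg_add, deg_listEdges_cons_self hB hB0,
    ← listEdges_reverse (A ++ [v])] at h
  rw [show (A ++ [v]).reverse = v :: A.reverse by simp,
    deg_listEdges_cons_self (by simpa using hA) (by simpa using hA0)] at h
  exact absurd h (by decide)

end

/-! ### Extracting elements from a decomposition -/

section

variable {V : Type*}

theorem Dec.path_of_eq {E F : Multiset (Sym2 V)} {k t : ℕ} {l : List V} (h : Dec F k t)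
    (hl : l.Nodup) (hE : E = listEdges l + F) : Dec E (k + 1) t :=
  hE ▸ h.path l hl

theorem Dec.tri_of_eq {E F : Multiset (Sym2 V)} {k t : ℕ} {x y z : V} (h : Dec F k t)
    (hxy : x ≠ y) (hyz : y ≠ z) (hzx : z ≠ x) (hE : E = triEdges x y z + F) :
    Dec E (k + 1) (t + 1) :=
  hE ▸ h.tri hxy hyz hzx

/-- Pad with edgeless paths. -/
theorem Dec.mono {E : Multiset (Sym2 V)} {k k' t : ℕ} (h : Dec E k t) (hk : k ≤ k') :
    Dec E k' t := by
  induction k', hk using Nat.le_induction with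
  | base => exact h
  | succ n _ ih => exact ih.path_of_eq (l := []) (by simp) (by simp)

theorem exists_triEdges_eq {x y z p q : V} (hxy : x ≠ y) (hyz : y ≠ z) (hzx : z ≠ x)
    (h : s(p, q) ∈ triEdges x y z) :
    ∃ w, triEdges x y z = triEdges p q w ∧ p ≠ q ∧ q ≠ w ∧ w ≠ p := by
  have hs (a b c : V) : triEdges a b c = triEdges b a c := by
    rw [triEdges_rotate, triEdges_swap]
  simp only [triEdges, Multiset.mem_add, Multiset.mem_singleton, Sym2.eq_iff] at h
  rcases h with ((⟨rfl, rfl⟩ | ⟨rfl, rfl⟩) | (⟨rfl, rfl⟩ | ⟨rfl, rfl⟩)) | (⟨rfl, rfl⟩ | ⟨rfl, rfl⟩)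
  · exact ⟨z, rfl, hxy, hyz, hzx⟩
  · exact ⟨z, hs _ _ _, hxy.symm, hzx.symm, hyz.symm⟩
  · exact ⟨x, triEdges_rotate _ _ _, hyz, hzx, hxy⟩
  · exact ⟨x, by rw [triEdges_rotate, hs], hyz.symm, hxy.symm, hzx.symm⟩
  · exact ⟨y, by rw [triEdges_rotate, triEdges_rotate], hzx, hxy, hyz⟩
  · exact ⟨y, by rw [triEdges_rotate, triEdges_rotate, hs], hzx.symm, hyz.symm, hxy.symm⟩

theorem Dec.exists_element {E : Multiset (Sym2 V)} {k t : ℕ} {e : Sym2 V} (h : Dec E k t)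
    (he : e ∈ E) :
    (∃ l F j, l.Nodup ∧ e ∈ listEdges l ∧ E = listEdges l + F ∧ k = j + 1 ∧ Dec F j t) ∨
    (∃ x y z F j s, x ≠ y ∧ y ≠ z ∧ z ≠ x ∧ e ∈ triEdges x y z ∧ E = triEdges x y z + F ∧
      k = j + 1 ∧ t = s + 1 ∧ Dec F j s) := by
  induction h with
  | zero => simp at he
  | @path E k t l hl h ih =>
    by_cases hel : e ∈ listEdges l
    · exact Or.inl ⟨l, E, k, hl, hel, rfl, rfl, h⟩
    rcases ih ((Multiset.mem_add.1 he).resolve_left hel) with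
      ⟨l', F, j, h1, h2, rfl, rfl, h5⟩ | ⟨x, y, z, F, j, s, h1, h2, h3, h4, rfl, rfl, rfl, h5⟩
    · exact Or.inl ⟨l', _, _, h1, h2, add_left_comm _ _ _, rfl, h5.path l hl⟩
    · exact Or.inr ⟨x, y, z, _, _, _, h1, h2, h3, h4, add_left_comm _ _ _, rfl, rfl, h5.path l hl⟩
  | @tri E k t a b c hab hbc hca h ih =>
    by_cases hel : e ∈ triEdges a b c
    · exact Or.inr ⟨a, b, c, E, k, t, hab, hbc, hca, hel, rfl, rfl, rfl, h⟩
    rcases ih ((Multiset.mem_add.1 he).resolve_left hel) with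
      ⟨l', F, j, h1, h2, rfl, rfl, h5⟩ | ⟨x, y, z, F, j, s, h1, h2, h3, h4, rfl, rfl, rfl, h5⟩
    · exact Or.inl ⟨l', _, _, h1, h2, add_left_comm _ _ _, rfl, h5.tri hab hbc hca⟩
    · exact Or.inr ⟨x, y, z, _, _, _, h1, h2, h3, h4, add_left_comm _ _ _, rfl, rfl,
        h5.tri hab hbc hca⟩

theorem Dec.exists_tri {E : Multiset (Sym2 V)} {k t : ℕ} (h : Dec E k (t + 1)) :
    ∃ x y z F j, x ≠ y ∧ y ≠ z ∧ z ≠ x ∧ E = triEdges x y z + F ∧ k = j + 1 ∧ Dec F j t := by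
  generalize ht : t + 1 = u at h
  induction h with
  | zero => simp at ht
  | @path E k u l hl h ih =>
    obtain ⟨x, y, z, F, j, h1, h2, h3, rfl, rfl, h5⟩ := ih ht
    exact ⟨x, y, z, _, _, h1, h2, h3, add_left_comm _ _ _, rfl, h5.path l hl⟩
  | @tri E k u a b c hab hbc hca h ih =>
    obtain rfl : t = u := by omega
    exact ⟨a, b, c, E, k, hab, hbc, hca, rfl, rfl, h⟩

/-- The element of a decomposition through a vertex `z` falls apart into two paths ending at `z`,
one of which avoids a prescribed vertex. -/
theorem Dec.exists_split {E : Multiset (Sym2 V)} {k t : ℕ} {e : Sym2 V} {z : V} (h : Dec E k t)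
    (he : e ∈ E) (hz : z ∈ e) (a : V) :
    ∃ l₁ l₂ F j s, (z :: l₁).Nodup ∧ (z :: l₂).Nodup ∧ a ∉ l₁ ∧
      E = listEdges (z :: l₁) + listEdges (z :: l₂) + F ∧ k = j + 1 ∧ Dec F j s := by
  rcases h.exists_element he with
    ⟨l, F, j, h1, h2, rfl, rfl, h5⟩ | ⟨x, y, w, F, j, s, h1, h2, h3, h4, rfl, rfl, rfl, h5⟩
  · obtain ⟨A, B, rfl⟩ := List.append_of_mem (mem_of_mem_listEdges h2 hz)
    have hr : (A ++ [z]).reverse = z :: A.reverse := by simp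
    have hA : (z :: A.reverse).Nodup := by
      rw [← hr]
      exact List.nodup_reverse.2 (h1.sublist (by simp))
    have hB : (z :: B).Nodup := h1.sublist (by simp)
    have hE : listEdges (A ++ z :: B) = listEdges (z :: A.reverse) + listEdges (z :: B) := by
      rw [listEdges_append_cons, ← hr, listEdges_reverse]
    by_cases haA : a ∈ A
    · refine ⟨B, A.reverse, F, j, t, hB, hA, ?_, by rw [hE, add_comm (listEdges (z :: B))], rfl, h5⟩
      intro haB
      exact (List.nodup_append.1 h1).2.2 a haA a (by simp [haB]) rfl
    · exact ⟨A.reverse, B, F, j, t, hA, hB, by simpa using haA, by rw [hE], rfl, h5⟩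
  · obtain ⟨q, rfl⟩ := hz
    obtain ⟨w', h6, h7, h8, h9⟩ := exists_triEdges_eq h1 h2 h3 h4
    rw [h6]
    -- A triangle cut at `z` gives a single edge and the two-edge path around the other way; the
    -- single edge goes to a corner other than `a`.
    by_cases haq : a = q
    · refine ⟨[w'], [q, w'], F, j, s, by simp [h9.symm], by simp [h7, h8, h9.symm], ?_, ?_, rfl, h5⟩
      · rw [haq]; simp [h8]
      · simp [triEdges, ← Multiset.singleton_add, Sym2.eq_swap (a := w')]; abel
    · refine ⟨[q], [w', q], F, j, s, by simp [h7], by simp [h7, h8.symm, h9.symm], by simp [haq],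
        ?_, rfl, h5⟩
      simp [triEdges, ← Multiset.singleton_add, Sym2.eq_swap (a := w')]; abel

variable [DecidableEq V]

theorem even_deg_triEdges {x y z : V} (hxy : x ≠ y) (hyz : y ≠ z) (hzx : z ≠ x) (v : V) :
    Even (deg v (triEdges x y z)) := by
  simp only [triEdges, deg_add, deg_singleton]
  by_cases h1 : v = x <;> by_cases h2 : v = y <;> by_cases h3 : v = z <;> simp_all [Nat.even_iff]

/-- Triangles, and paths not ending at `v`, contribute an even number to the degree of `v`. -/
theorem Dec.exists_end_of_odd {E : Multiset (Sym2 V)} {k t : ℕ} {v : V} (h : Dec E k t)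
    (hv : Odd (deg v E)) :
    ∃ l F j, l ≠ [] ∧ (v :: l).Nodup ∧ E = listEdges (v :: l) + F ∧ k = j + 1 ∧ Dec F j t := by
  induction h with
  | zero => simp at hv
  | @path E k t l hl h ih =>
    by_cases hel : Odd (deg v (listEdges l))
    · obtain ⟨l', h1, h2, h3, -⟩ := PathDecomposition.exists_end_of_odd hl hel
      exact ⟨l', E, k, h1, h2, by rw [h3], rfl, h⟩
    rw [deg_add] at hv
    obtain ⟨l', F, j, h1, h2, rfl, rfl, h5⟩ := ih (by grind)
    exact ⟨l', _, _, h1, h2, add_left_comm _ _ _, rfl, h5.path l hl⟩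
  | @tri E k t a b c hab hbc hca h ih =>
    have := even_deg_triEdges hab hbc hca v
    rw [deg_add] at hv
    obtain ⟨l', F, j, h1, h2, rfl, rfl, h5⟩ := ih (by grind)
    exact ⟨l', _, _, h1, h2, add_left_comm _ _ _, rfl, h5.tri hab hbc hca⟩

theorem notMem_of_deg_eq_zero {l : List V} {a v : V} {F : Multiset (Sym2 V)}
    (h : deg v (listEdges (a :: l) + F) = 0) : v ∉ l := fun hv => by
  have := deg_listEdges_cons_pos (a := a) hv
  rw [deg_add] at h
  omega

end

/-! ### Adding edges to a decomposition -/

section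

variable {V : Type*} [DecidableEq V]

/-- Cut an element at `z` and prolong the half avoiding `a` by `z w a v`, the other half by `z v`.
-/
theorem Dec.add_fourCycle {E : Multiset (Sym2 V)} {k t : ℕ} {e : Sym2 V} {z a v w : V}
    (h : Dec E k t) (he : e ∈ E) (hz : z ∈ e) (hv : deg v E = 0) (hw : deg w E = 0)
    (hza : z ≠ a) (hzv : z ≠ v) (hzw : z ≠ w) (hav : a ≠ v) (haw : a ≠ w) (hvw : v ≠ w) :
    ∃ s, Dec ({s(z, v)} + {s(v, a)} + {s(a, w)} + {s(w, z)} + E) (k + 1) s := by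
  obtain ⟨l₁, l₂, F, j, s, h1, h2, h3, rfl, rfl, h4⟩ := h.exists_split he hz a
  rw [add_assoc] at hv hw
  have hv1 : v ∉ l₁ := notMem_of_deg_eq_zero hv
  have hw1 : w ∉ l₁ := notMem_of_deg_eq_zero hw
  rw [add_left_comm] at hv
  have hv2 : v ∉ l₂ := notMem_of_deg_eq_zero hv
  refine ⟨s, (h4.path (v :: a :: w :: z :: l₁) ?_).path_of_eq (l := v :: z :: l₂) ?_ ?_⟩
  · simp at h1 ⊢; grind
  · simp at h2 ⊢; grind
  · simp only [listEdges_cons_cons, ← Multiset.singleton_add, Sym2.eq_swap (a := v) (b := z)]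
    abel

/-- Cut an element at `b` and prolong the half avoiding `a` by `b z a`, the other half by `b v z`.
-/
theorem Dec.add_triangle_edge {E : Multiset (Sym2 V)} {k t : ℕ} {e : Sym2 V} {z a b v : V}
    (h : Dec E k t) (he : e ∈ E) (hb : b ∈ e) (hz : deg z E = 0) (hv : deg v E = 0)
    (hza : z ≠ a) (hzb : z ≠ b) (hzv : z ≠ v) (hab : a ≠ b) (hbv : b ≠ v) :
    ∃ s, Dec ({s(z, a)} + {s(z, b)} + {s(z, v)} + {s(v, b)} + E) (k + 1) s := by
  obtain ⟨l₁, l₂, F, j, s, h1, h2, h3, rfl, rfl, h4⟩ := h.exists_split he hb a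
  rw [add_assoc] at hv hz
  have hz1 : z ∉ l₁ := notMem_of_deg_eq_zero hz
  rw [add_left_comm] at hv hz
  have hv2 : v ∉ l₂ := notMem_of_deg_eq_zero hv
  have hz2 : z ∉ l₂ := notMem_of_deg_eq_zero hz
  refine ⟨s, (h4.path (a :: z :: b :: l₁) ?_).path_of_eq (l := z :: v :: b :: l₂) ?_ ?_⟩
  · simp at h1 ⊢; grind
  · simp at h2 ⊢; grind
  · simp only [listEdges_cons_cons, ← Multiset.singleton_add, Sym2.eq_swap (a := a) (b := z)]
    abel

theorem Dec.add_edge_of_odd {E : Multiset (Sym2 V)} {k t : ℕ} {z a : V} {l : List V}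
    (h : Dec E k t) (ha : Odd (deg a E)) (hz : deg z E = 0) (hza : z ≠ a) (hl : l.Nodup) :
    Dec ({s(z, a)} + listEdges l + E) (k + 1) t := by
  obtain ⟨m, F, j, -, h1, rfl, rfl, h2⟩ := h.exists_end_of_odd ha
  have hz1 : z ∉ m := notMem_of_deg_eq_zero hz
  refine (h2.path (z :: a :: m) ?_).path_of_eq hl ?_
  · simp at h1 ⊢; grind
  · simp only [listEdges_cons_cons, ← Multiset.singleton_add]
    abel

/-- A leaf `z` at a vertex `a` of odd degree is joined to the ends of an edge `vb`, which is
removed. -/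
theorem Dec.subdivide_by_leaf {R : Multiset (Sym2 V)} {k t : ℕ} {z a b v : V}
    (h : Dec ({s(z, a)} + {s(v, b)} + R) k t) (hz : deg z R = 0) (ha : Even (deg a R))
    (hv : deg v R ≤ 1) (hza : z ≠ a) (hzb : z ≠ b) (hzv : z ≠ v) (hab : a ≠ b) (hav : a ≠ v) :
    ∃ s, Dec ({s(z, a)} + {s(z, b)} + {s(z, v)} + R) k s := by
  have hdz : deg z ({s(z, a)} + {s(v, b)} + R) = 1 := by simp [hz, hzb, hzv]
  have hda : Odd (deg a ({s(z, a)} + {s(v, b)} + R)) := by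
    simp [hab, hav]; exact ha.one_add
  have hdv : deg v ({s(z, a)} + {s(v, b)} + R) ≤ 2 := by
    simp [hzv.symm, hav.symm]; omega
  rcases h.exists_element (e := s(v, b)) (by simp) with
    ⟨l, F, j, h1, h2, h3, rfl, h5⟩ | ⟨x, y, w, F, j, s, h1, h2, h3, h4, h5, rfl, rfl, h6⟩
  · rw [h3] at hdz hda hdv
    -- If the path avoids `z`, subdividing `vb` by `z` suffices. Otherwise the leaf `z` is its end,
    -- next to `a`, and `za` has to move to another path before `z` can subdivide.
    by_cases hzl : z ∈ l
    · have hpos : deg z (listEdges l) = 1 := by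
        cases l with
        | nil => simp at hzl
        | cons c l =>
          rcases List.mem_cons.1 hzl with rfl | hzl
          · refine deg_listEdges_cons_self (List.nodup_cons.1 h1).1 ?_
            rintro rfl; simp at h2
          · have := deg_listEdges_cons_pos (a := c) hzl
            rw [deg_add] at hdz; omega
      obtain ⟨l', hl0, hl1, hl2, -⟩ := PathDecomposition.exists_end_of_odd h1 (v := z)
        (by rw [hpos]; decide)
      obtain ⟨c, l'', rfl⟩ := List.exists_cons_of_ne_nil hl0
      have hca : c = a := by
        have hmem : s(z, c) ∈ ({s(z, a)} + {s(v, b)} + R : Multiset (Sym2 V)) := by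
          rw [h3, ← hl2]; simp
        simp only [Multiset.mem_add, Multiset.mem_singleton] at hmem
        rcases hmem with (hm | hm) | hm
        · exact Sym2.congr_right.1 hm
        · rw [Sym2.eq_iff] at hm; grind
        · exact absurd (Sym2.mem_mk_left z c) (deg_eq_zero.1 hz _ hm)
      subst hca
      rw [← hl2] at h2 h3 hda hdz hpos
      have hvb : s(v, b) ∈ listEdges (c :: l'') := by
        rw [listEdges_cons_cons, Multiset.mem_cons] at h2
        refine h2.resolve_left ?_
        rw [Sym2.eq_iff]; grind
      have hzc : z ∉ c :: l'' := (List.nodup_cons.1 hl1).1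
      have hc : c ∉ l'' := (List.nodup_cons.1 (List.nodup_cons.1 hl1).2).1
      -- The path continues beyond `c` to reach `vb`, so it takes 2 from the odd degree of `c`; some
      -- path of `F` therefore ends at `c` and can receive `zc`.
      have hodd : Odd (deg c F) := by
        rw [deg_add, listEdges_cons_cons, deg_cons, deg_listEdges_cons_self hc] at hda
        · simp at hda; grind
        · rintro rfl; simp at hvb
      obtain ⟨m, F', i, -, hm1, rfl, rfl, hm2⟩ := h5.exists_end_of_odd hodd
      have hzm : z ∉ m := by
        refine notMem_of_deg_eq_zero (a := c) (F := F') ?_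
        rw [deg_add] at hdz; omega
      obtain ⟨n, hn1, hn2⟩ := exists_subdivide (List.nodup_cons.1 hl1).2 hvb hzc
      refine ⟨t, (hm2.path (z :: c :: m) ?_).path_of_eq hn1 ?_⟩
      · simp at hm1 ⊢; grind
      -- With `vb` added on both sides, the hypotheses apply without multiset subtraction.
      · refine add_right_cancel (b := ({s(v, b)} : Multiset (Sym2 V))) ?_
        calc _ = ({s(z, c)} + {s(v, b)} + R) + ({s(z, v)} + {s(z, b)}) := by abel
          _ = (listEdges (c :: l'') + ({s(z, v)} + {s(z, b)})) +
              (listEdges (z :: c :: m) + F') := by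
            rw [h3]; simp only [listEdges_cons_cons, ← Multiset.singleton_add]; abel
          _ = _ := by rw [← hn2]; abel
    · obtain ⟨n, hn1, hn2⟩ := exists_subdivide h1 h2 hzl
      refine ⟨t, h5.path_of_eq hn1 ?_⟩
      refine add_right_cancel (b := ({s(v, b)} : Multiset (Sym2 V))) ?_
      calc _ = ({s(z, a)} + {s(v, b)} + R) + ({s(z, v)} + {s(z, b)}) := by abel
        _ = (listEdges l + ({s(z, v)} + {s(z, b)})) + F := by rw [h3]; abel
        _ = _ := by rw [← hn2]; abel
  · obtain ⟨w', h7, h8, h9, h10⟩ := exists_triEdges_eq h1 h2 h3 h4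
    rw [h7] at h5
    have hzw : z ≠ w' := by
      rintro rfl
      have hmem : s(z, v) ∈ ({s(z, a)} + {s(v, b)} + R : Multiset (Sym2 V)) := by
        rw [h5]; simp [triEdges]
      simp only [Multiset.mem_add, Multiset.mem_singleton] at hmem
      rcases hmem with (hm | hm) | hm
      · exact hav (Sym2.congr_right.1 hm).symm
      · rw [Sym2.eq_iff] at hm; grind
      · exact absurd (Sym2.mem_mk_left z v) (deg_eq_zero.1 hz _ hm)
    rw [h5] at hdz hdv
    have hzt : deg z (triEdges v b w') = 0 := by simp [triEdges, hzv, hzb, hzw]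
    have hvt : deg v (triEdges v b w') = 2 := by simp [triEdges, h8, h10.symm]
    rw [deg_add, hzt, zero_add] at hdz
    -- The path ending at the leaf `z` is prolonged to `v`, which it avoids since the triangle uses
    -- up the degree of `v`; the triangle turns into `v w' b z`.
    obtain ⟨m, F', i, -, hm1, rfl, rfl, hm2⟩ := h6.exists_end_of_odd (v := z) (by rw [hdz]; decide)
    have hvm : v ∉ m := by
      refine notMem_of_deg_eq_zero (a := z) (F := F') ?_
      rw [deg_add] at hdv; omega
    refine ⟨s, (hm2.path (v :: z :: m) ?_).path_of_eq (l := [v, w', b, z]) ?_ ?_⟩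
    · simp at hm1 ⊢; grind
    · simp; grind
    · refine add_right_cancel (b := ({s(v, b)} : Multiset (Sym2 V))) ?_
      calc _ = ({s(z, a)} + {s(v, b)} + R) + ({s(z, v)} + {s(z, b)}) := by abel
        _ = _ := by
          rw [h5]
          simp only [listEdges_cons_cons, listEdges_singleton, ← Multiset.singleton_add, triEdges,
            Sym2.eq_swap (a := w') (b := v), Sym2.eq_swap (a := w') (b := b),
            Sym2.eq_swap (a := z) (b := v), Sym2.eq_swap (a := z) (b := b)]
          abel

end

/-! ### Reducible configurations -/

section

variable {V : Type*} [DecidableEq V]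

/-- `E` is the edge multiset of a simple 2-degenerate graph without edges outside `W`. -/
structure TwoDegenerateOn (W : Finset V) (E : Multiset (Sym2 V)) : Prop where
  nodup : E.Nodup
  ne : ∀ ⦃u v⦄, s(u, v) ∈ E → u ≠ v
  mem : ∀ ⦃u v⦄, s(u, v) ∈ E → u ∈ W
  degenerate : ∀ U : Finset V, U.Nonempty → ∃ v ∈ U, {u ∈ U | s(v, u) ∈ E}.card ≤ 2

/-- Edge multisets below `W` and `E` in the induction have decompositions. -/
def DecBelow (W : Finset V) (E : Multiset (Sym2 V)) : Prop :=
  ∀ (W' : Finset V) (E' : Multiset (Sym2 V)), TwoDegenerateOn W' E' → W'.card + E'.card < W.card + E.card →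
    ∃ t, Dec E' (W'.card / 2) t

theorem deg_eq_zero_iff_forall {v : V} {E : Multiset (Sym2 V)} :
    deg v E = 0 ↔ ∀ u, s(v, u) ∉ E := by
  rw [deg_eq_zero]
  refine ⟨fun h u hu => h _ hu (by simp), ?_⟩
  rintro h e he ⟨u, rfl⟩
  exact h u he

variable {W : Finset V} {E : Multiset (Sym2 V)}

theorem TwoDegenerateOn.exists_tail (h : TwoDegenerateOn W E) {v z : V} (hvz : s(v, z) ∈ E)
    (hv : {u ∈ W | s(v, u) ∈ E}.card ≤ 2) :
    (∀ u, s(v, u) ∈ E → u = z) ∨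
      ∃ c, c ≠ z ∧ c ≠ v ∧ s(v, c) ∈ E ∧ ∀ u, s(v, u) ∈ E → u = z ∨ u = c := by
  by_cases hc : ∃ c, c ≠ z ∧ s(v, c) ∈ E
  · obtain ⟨c, hcz, hvc⟩ := hc
    refine Or.inr ⟨c, hcz, (h.ne hvc).symm, hvc, fun u hu => ?_⟩
    by_contra! hne
    have hsub : ({u, z, c} : Finset V) ⊆ {u ∈ W | s(v, u) ∈ E} := by
      intro x hx
      have hx' : s(v, x) ∈ E := by
        simp only [Finset.mem_insert, Finset.mem_singleton] at hx
        rcases hx with rfl | rfl | rfl <;> assumption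
      exact Finset.mem_filter.2 ⟨h.mem (Sym2.eq_swap ▸ hx'), hx'⟩
    have h3 : ({u, z, c} : Finset V).card = 3 :=
      Finset.card_eq_three.2 ⟨u, z, c, hne.1, hne.2, hcz.symm, rfl⟩
    have := Finset.card_le_card hsub
    omega
  · push Not at hc
    exact Or.inl fun u hu => by_contra fun hne => hc u hne hu

/-- `F` contains all edges at `v` and `w`, so induction applies to the rest without these two
vertices and leaves room for one more element. -/
theorem TwoDegenerateOn.exists_dec_sub (h : TwoDegenerateOn W E) (ih : DecBelow W E)
    {F : Multiset (Sym2 V)} (hF : F.Nodup) (hFE : ∀ e ∈ F, e ∈ E) {v w : V} (hvw : v ≠ w)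
    (hvW : v ∈ W) (hwW : w ∈ W) (hv : ∀ u, s(v, u) ∈ E → s(v, u) ∈ F)
    (hw : ∀ u, s(w, u) ∈ E → s(w, u) ∈ F) :
    ∃ k t, W.card / 2 = k + 1 ∧ F + (E - F) = E ∧ deg v (E - F) = 0 ∧ deg w (E - F) = 0 ∧
      Dec (E - F) k t := by
  have hmem (e) : e ∈ E - F ↔ e ∈ E ∧ e ∉ F := Multiset.mem_sub_of_nodup h.nodup
  have hle : F ≤ E := (Multiset.le_iff_subset hF).2 hFE
  have hcard : ((W.erase v).erase w).card + 2 = W.card := by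
    have h1 := Finset.card_erase_add_one hvW
    have h2 := Finset.card_erase_add_one (Finset.mem_erase.2 ⟨hvw.symm, hwW⟩)
    omega
  have hadm : TwoDegenerateOn ((W.erase v).erase w) (E - F) := by
    refine ⟨Multiset.nodup_of_le (Multiset.sub_le_self E F) h.nodup,
      fun x y hxy => h.ne ((hmem _).1 hxy).1, fun x y hxy => ?_, fun U hU => ?_⟩
    · have hxy' := (hmem _).1 hxy
      refine Finset.mem_erase.2 ⟨?_, Finset.mem_erase.2 ⟨?_, h.mem hxy'.1⟩⟩
      · rintro rfl; exact hxy'.2 (hw _ hxy'.1)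
      · rintro rfl; exact hxy'.2 (hv _ hxy'.1)
    · obtain ⟨x, hx, hxc⟩ := h.degenerate U hU
      refine ⟨x, hx, (Finset.card_le_card fun u hu => ?_).trans hxc⟩
      rw [Finset.mem_filter] at hu ⊢
      exact ⟨hu.1, ((hmem _).1 hu.2).1⟩
  obtain ⟨t, ht⟩ := ih _ _ hadm (by
    have := Multiset.card_le_card (Multiset.sub_le_self E F)
    omega)
  exact ⟨_, t, by omega, add_tsub_cancel_of_le hle,
    deg_eq_zero_iff_forall.2 fun u hu => ((hmem _).1 hu).2 (hv _ ((hmem _).1 hu).1),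
    deg_eq_zero_iff_forall.2 fun u hu => ((hmem _).1 hu).2 (hw _ ((hmem _).1 hu).1), ht⟩

theorem TwoDegenerateOn.exists_dec_of_path (h : TwoDegenerateOn W E) (ih : DecBelow W E)
    {l : List V} (hl : l.Nodup) (hlE : ∀ e ∈ listEdges l, e ∈ E) {v w : V} (hvw : v ≠ w)
    (hvW : v ∈ W) (hwW : w ∈ W) (hv : ∀ u, s(v, u) ∈ E → s(v, u) ∈ listEdges l)
    (hw : ∀ u, s(w, u) ∈ E → s(w, u) ∈ listEdges l) :
    ∃ t, Dec E (W.card / 2) t := by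
  obtain ⟨k, t, hk, hE, -, -, hd⟩ :=
    h.exists_dec_sub ih (nodup_listEdges hl) hlE hvw hvW hwW hv hw
  rw [hk]
  exact ⟨t, hd.path_of_eq hl hE.symm⟩

/-- Two adjacent vertices of degree at most two. -/
theorem TwoDegenerateOn.exists_dec_of_adj (h : TwoDegenerateOn W E) (ih : DecBelow W E)
    {v w : V} (hvw : s(v, w) ∈ E) (hv : {u ∈ W | s(v, u) ∈ E}.card ≤ 2)
    (hw : {u ∈ W | s(w, u) ∈ E}.card ≤ 2) : ∃ t, Dec E (W.card / 2) t := by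
  have hwv : s(w, v) ∈ E := Sym2.eq_swap ▸ hvw
  have hne := h.ne hvw
  have hvW := h.mem hvw
  have hwW := h.mem hwv
  rcases h.exists_tail hvw hv with hv | ⟨c, hcw, hcv, hvc, hv⟩ <;>
    rcases h.exists_tail hwv hw with hw | ⟨d, hdv, hdw, hwd, hw⟩
  · exact h.exists_dec_of_path ih (l := [v, w]) (by simp [hne]) (by simp [hvw]) hne hvW hwW
      (by simp; grind) (by simp; grind)
  · exact h.exists_dec_of_path ih (l := [v, w, d]) (by simp; grind) (by simp; grind) hne hvW hwW
      (by simp; grind) (by simp; grind)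
  · exact h.exists_dec_of_path ih (l := [w, v, c]) (by simp; grind) (by simp; grind) hne hvW hwW
      (by simp; grind) (by simp; grind)
  -- A common second neighbor closes a triangle; this is the only place where the induction creates
  -- one.
  · by_cases hcd : c = d
    · subst hcd
      obtain ⟨k, t, hk, hE, -, -, hd⟩ := h.exists_dec_sub ih (F := triEdges v w c)
        (by simp [triEdges]; grind)
        (by simp [triEdges]; grind [Sym2.eq_swap]) hne hvW hwW (by simp [triEdges]; grind)
        (by simp [triEdges]; grind)
      rw [hk]
      exact ⟨_, hd.tri_of_eq hne hdw.symm hcv hE.symm⟩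
    · exact h.exists_dec_of_path ih (l := [c, v, w, d]) (by simp; grind)
        (by simp; grind [Sym2.eq_swap]) hne hvW hwW (by simp; grind) (by simp; grind)

/-- Two nonadjacent vertices of degree at most two with a common neighbor. -/
theorem TwoDegenerateOn.exists_dec_of_common_neighbor (h : TwoDegenerateOn W E)
    (ih : DecBelow W E) {v w z y : V} (hne : v ≠ w) (hvw : s(v, w) ∉ E) (hzv : s(z, v) ∈ E)
    (hzw : s(z, w) ∈ E) (hzy : s(z, y) ∈ E) (hyv : y ≠ v) (hyw : y ≠ w)
    (hv : {u ∈ W | s(v, u) ∈ E}.card ≤ 2) (hw : {u ∈ W | s(w, u) ∈ E}.card ≤ 2) :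
    ∃ t, Dec E (W.card / 2) t := by
  have hvz : s(v, z) ∈ E := Sym2.eq_swap ▸ hzv
  have hwz : s(w, z) ∈ E := Sym2.eq_swap ▸ hzw
  have hwv : s(w, v) ∉ E := Sym2.eq_swap ▸ hvw
  have hvW := h.mem hvz
  have hwW := h.mem hwz
  have h1 := h.ne hvz
  have h2 := h.ne hwz
  rcases h.exists_tail hvz hv with hv | ⟨c, hcz, hcv, hvc, hv⟩ <;>
    rcases h.exists_tail hwz hw with hw | ⟨d, hdz, hdw, hwd, hw⟩
  · exact h.exists_dec_of_path ih (l := [v, z, w]) (by simp; grind) (by simp; grind) hne hvW hwW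
      (by simp; grind) (by simp; grind)
  · have : d ≠ v := by rintro rfl; contradiction
    exact h.exists_dec_of_path ih (l := [v, z, w, d]) (by simp; grind) (by simp; grind) hne hvW hwW
      (by simp; grind) (by simp; grind)
  · have : c ≠ w := by rintro rfl; contradiction
    exact h.exists_dec_of_path ih (l := [w, z, v, c]) (by simp; grind) (by simp; grind) hne hvW hwW
      (by simp; grind) (by simp; grind)
  · have hdv : d ≠ v := by rintro rfl; contradiction
    have hcw : c ≠ w := by rintro rfl; contradiction
    by_cases hcd : c = d
    · subst hcd
      obtain ⟨k, t, hk, hE, hv0, hw0, hd⟩ := h.exists_dec_sub ih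
        (F := {s(z, v)} + {s(v, c)} + {s(c, w)} + {s(w, z)})
        (by simp; grind)
        (by simp; grind [Sym2.eq_swap]) hne hvW hwW (by simp; grind)
        (by simp; grind)
      -- The edge `zy` guarantees an element through `z` to absorb the four-cycle.
      have hy : s(z, y) ∈ E - ({s(z, v)} + {s(v, c)} + {s(c, w)} + {s(w, z)}) := by
        rw [Multiset.mem_sub_of_nodup h.nodup]
        refine ⟨hzy, ?_⟩
        simp; grind
      obtain ⟨s, hs⟩ := hd.add_fourCycle hy (by simp) hv0 hw0 hcz.symm h1.symm h2.symm hcv hdw hne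
      rw [hk, ← hE]
      exact ⟨s, hs⟩
    · exact h.exists_dec_of_path ih (l := [c, v, z, w, d]) (by simp; grind)
        (by simp; grind [Sym2.eq_swap]) hne hvW hwW (by simp; grind) (by simp; grind)

/-- A vertex of degree three with a neighbor of degree two, where these two have a common
neighbor. -/
theorem TwoDegenerateOn.exists_dec_of_triangle (h : TwoDegenerateOn W E) (ih : DecBelow W E)
    {z a b v y : V} (hza : s(z, a) ∈ E) (hzb : s(z, b) ∈ E) (hzv : s(z, v) ∈ E)
    (hvb : s(v, b) ∈ E) (hby : s(b, y) ∈ E) (hab : a ≠ b) (hav : a ≠ v)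
    (hyz : y ≠ z) (hyv : y ≠ v) (hz : ∀ u, s(z, u) ∈ E → u = a ∨ u = b ∨ u = v)
    (hv : ∀ u, s(v, u) ∈ E → u = z ∨ u = b) : ∃ t, Dec E (W.card / 2) t := by
  have hvz : s(v, z) ∈ E := Sym2.eq_swap ▸ hzv
  have h1 := h.ne hza
  have h2 := h.ne hzb
  have h3 := h.ne hzv
  have h4 := h.ne hvb
  obtain ⟨k, t, hk, hE, hz0, hv0, hd⟩ := h.exists_dec_sub ih
    (F := {s(z, a)} + {s(z, b)} + {s(z, v)} + {s(v, b)})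
    (by simp; grind) (by simp; grind) h3 (h.mem hzv) (h.mem hvz)
    (by simp; grind) (by simp; grind)
  have hy : s(b, y) ∈ E - ({s(z, a)} + {s(z, b)} + {s(z, v)} + {s(v, b)}) := by
    rw [Multiset.mem_sub_of_nodup h.nodup]
    refine ⟨hby, ?_⟩
    simp; grind
  obtain ⟨s, hs⟩ := hd.add_triangle_edge hy (by simp) hz0 hv0 h1 h2 h3 hab h4.symm
  rw [hk, ← hE]
  exact ⟨s, hs⟩

/-- A vertex of degree three with a neighbor of degree at most two and a neighbor `a` of even
degree. -/
theorem TwoDegenerateOn.exists_dec_of_even (h : TwoDegenerateOn W E) (ih : DecBelow W E)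
    {z a b v : V} {l : List V} (hza : s(z, a) ∈ E) (hzv : s(z, v) ∈ E)
    (ha : Even (deg a E)) (hz : ∀ u, s(z, u) ∈ E → u = a ∨ u = b ∨ u = v)
    (hl : (b :: z :: v :: l).Nodup) (hlE : ∀ e ∈ listEdges (b :: z :: v :: l), e ∈ E)
    (hal : a ∉ b :: z :: v :: l)
    (hv : ∀ u, s(v, u) ∈ E → s(v, u) ∈ listEdges (b :: z :: v :: l)) :
    ∃ t, Dec E (W.card / 2) t := by
  have hvz : s(v, z) ∈ E := Sym2.eq_swap ▸ hzv
  have h1 := h.ne hza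
  have hnot : s(z, a) ∉ listEdges (b :: z :: v :: l) := fun hm =>
    hal (mem_of_mem_listEdges hm (by simp))
  obtain ⟨k, t, hk, hE, hz0, hv0, hd⟩ := h.exists_dec_sub ih
    (F := {s(z, a)} + listEdges (b :: z :: v :: l))
    (by
      rw [Multiset.singleton_add, Multiset.nodup_cons]
      exact ⟨hnot, nodup_listEdges hl⟩)
    (by
      intro e he
      rw [Multiset.mem_add, Multiset.mem_singleton] at he
      rcases he with rfl | he
      exacts [hza, hlE _ he]) (h.ne hzv) (h.mem hzv) (h.mem hvz)
    (by simp; grind) (by simp at hv ⊢; grind)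
  -- Of the removed edges only `za` contains `a`, so the parity at `a` flips.
  have hodd : Odd (deg a (E - ({s(z, a)} + listEdges (b :: z :: v :: l)))) := by
    rw [← hE, deg_add, deg_add, deg_listEdges_of_notMem hal] at ha
    simp only [deg_singleton, or_true, if_true, add_zero, Nat.even_add, Nat.not_even_one, false_iff,
      Nat.not_even_iff_odd] at ha
    exact ha
  rw [hk, ← hE]
  exact ⟨t, hd.add_edge_of_odd hodd hz0 h1 hl⟩

/-- A vertex of degree three with a neighbor of degree at most two and a neighbor `a` of odd
degree. -/
theorem TwoDegenerateOn.exists_dec_of_odd (h : TwoDegenerateOn W E) (ih : DecBelow W E)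
    {z a b v : V} (hza : s(z, a) ∈ E) (hzb : s(z, b) ∈ E) (hzv : s(z, v) ∈ E)
    (hab : a ≠ b) (hav : a ≠ v) (hbv : b ≠ v) (ha : Odd (deg a E))
    (hz : ∀ u, s(z, u) ∈ E → u = a ∨ u = b ∨ u = v) (hvb : s(v, b) ∉ E) {c : V}
    (hv : ∀ u, s(v, u) ∈ E → u = z ∨ u = c) : ∃ t, Dec E (W.card / 2) t := by
  have hvz : s(v, z) ∈ E := Sym2.eq_swap ▸ hzv
  have hbz : s(b, z) ∈ E := Sym2.eq_swap ▸ hzb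
  have haz : s(a, z) ∈ E := Sym2.eq_swap ▸ hza
  have h1 := h.ne hza
  have h2 := h.ne hzb
  have h3 := h.ne hzv
  set F : Multiset (Sym2 V) := {s(z, a)} + {s(z, b)} + {s(z, v)} with hF
  have hFn : F.Nodup := by simp [hF]; grind
  have hFE : F ≤ E := (Multiset.le_iff_subset hFn).2 fun e he => by
    simp [hF] at he; grind
  have hE : F + (E - F) = E := add_tsub_cancel_of_le hFE
  have hmem (e) : e ∈ E - F ↔ e ∈ E ∧ e ∉ F := Multiset.mem_sub_of_nodup h.nodup
  set R := E - F with hR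
  have hRn : R.Nodup := Multiset.nodup_of_le (Multiset.sub_le_self E F) h.nodup
  have hzR : ∀ u, s(z, u) ∉ R := fun u hu => by
    rw [hmem] at hu
    rcases hz u hu.1 with rfl | rfl | rfl <;> simp [hF] at hu
  have hvR : ∀ u, s(v, u) ∈ R → u = c := fun u hu => by
    rcases hv u ((hmem _).1 hu).1 with rfl | rfl
    · exact absurd (Sym2.eq_swap ▸ hu) (hzR v)
    · rfl
  have hz0 : deg z R = 0 := deg_eq_zero_iff_forall.2 hzR
  have hv1 : deg v R ≤ 1 := by
    have hle : Multiset.filter (v ∈ ·) R ≤ {s(v, c)} := by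
      rw [Multiset.le_iff_subset (hRn.filter _)]
      intro e he
      obtain ⟨heR, u, rfl⟩ := Multiset.mem_filter.1 he
      simp [hvR u heR]
    rw [deg, Multiset.countP_eq_card_filter]
    simpa using Multiset.card_le_card hle
  have haR : Even (deg a R) := by
    rw [← hE, hF, deg_add] at ha
    simp [hab, hav] at ha
    grind
  -- No vertex is removed here; the induction measure drops by one edge.
  have hcard : Multiset.card ({s(z, a)} + {s(v, b)} + R) + 1 = Multiset.card E := by
    have := congrArg Multiset.card hE
    simp [hF] at this ⊢; omega
  have hadm : TwoDegenerateOn W ({s(z, a)} + {s(v, b)} + R) := by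
    refine ⟨?_, ?_, ?_, ?_⟩
    · rw [add_assoc, Multiset.singleton_add, Multiset.singleton_add, Multiset.nodup_cons,
        Multiset.nodup_cons]
      refine ⟨?_, fun hm => hvb ((hmem _).1 hm).1, hRn⟩
      rw [Multiset.mem_cons]
      rintro (hm | hm)
      · rw [Sym2.eq_iff] at hm; grind
      · exact hzR a hm
    · intro x y hxy
      simp only [Multiset.mem_add, Multiset.mem_singleton, Sym2.eq_iff] at hxy
      have := @h.ne x y
      grind
    · intro x y hxy
      simp only [Multiset.mem_add, Multiset.mem_singleton, Sym2.eq_iff] at hxy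
      have := @h.mem x y
      have := h.mem hza
      have := h.mem hvz
      have := h.mem hbz
      have := h.mem haz
      grind
    · intro U hU
      -- In the new graph `v` has neighbors only among `b`, `c`, and `z` only `a`; a set avoiding
      -- both sees no new edge.
      by_cases hvU : v ∈ U
      · refine ⟨v, hvU, (Finset.card_le_card (t := {b, c}) fun u hu => ?_).trans
          Finset.card_le_two⟩
        have := hvR u
        simp at hu ⊢
        grind
      by_cases hzU : z ∈ U
      · refine ⟨z, hzU, (Finset.card_le_card (t := {a, a}) fun u hu => ?_).trans
          Finset.card_le_two⟩
        have := hzR u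
        simp at hu ⊢
        grind
      obtain ⟨x, hx, hxc⟩ := h.degenerate U hU
      refine ⟨x, hx, (Finset.card_le_card fun u hu => ?_).trans hxc⟩
      simp at hu ⊢
      have := hmem s(x, u)
      grind
  obtain ⟨t, ht⟩ := ih _ _ hadm (by omega)
  obtain ⟨s, hs⟩ := ht.subdivide_by_leaf hz0 haR hv1 h1 h2 h3 hab hav
  rw [← hE]
  exact ⟨s, hs⟩

end

/-! ### Redrawing a triangle and a touching element as two paths -/

section

variable {V : Type*}

theorem exists_first_mem {l : List V} {p : V → Prop} (h : ∃ v ∈ l, p v) :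
    ∃ A v B, l = A ++ v :: B ∧ p v ∧ ∀ a ∈ A, ¬ p a := by
  induction l with
  | nil => simp at h
  | cons c l ih =>
    by_cases hc : p c
    · exact ⟨[], c, l, rfl, hc, by simp⟩
    · obtain ⟨A, v, B, rfl, hv, hA⟩ := ih (by simpa [hc] using h)
      exact ⟨c :: A, v, B, rfl, hv, by simpa [hc] using hA⟩

/-- A triangle and a path that meet in a vertex, but in no edge, form two paths. -/
theorem exists_paths_of_triEdges_add_listEdges {x y z : V} {l : List V} (hxy : x ≠ y)
    (hyz : y ≠ z) (hzx : z ≠ x) (hl : l.Nodup) (hn : (triEdges x y z + listEdges l).Nodup)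
    (hm : ∃ v ∈ l, v = x ∨ v = y ∨ v = z) :
    ∃ l₁ l₂ : List V, l₁.Nodup ∧ l₂.Nodup ∧
      triEdges x y z + listEdges l = listEdges l₁ + listEdges l₂ := by
  obtain ⟨A, p, B, rfl, hp, hA⟩ := exists_first_mem hm
  wlog hpx : p = x generalizing x y z
  · have hrot := triEdges_rotate x y z
    rcases hp with hp | hp | hp
    · exact absurd hp hpx
    · rw [hrot] at hn ⊢
      exact this hyz hzx hxy hn (by grind) (by grind) (by grind) hp
    · rw [hrot, triEdges_rotate] at hn ⊢
      exact this hzx hxy hyz hn (by grind) (by grind) (by grind) hp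
  subst hpx
  -- `p` is the first corner on the path; `q`, if it exists, is the next one.
  by_cases hB : ∃ v ∈ B, v = y ∨ v = z
  · obtain ⟨C, q, D, rfl, hq, hC⟩ := exists_first_mem hB
    wlog hqy : q = y generalizing y z
    · rw [triEdges_swap] at hn ⊢
      apply this (y := z) (z := y) <;> first | exact hn | grind
    subst hqy
    -- If `q` followed `p` immediately, `pq` would lie on both the triangle and the path.
    cases C with
    | nil =>
      rw [Multiset.nodup_add] at hn
      refine absurd ?_ (Multiset.disjoint_left.1 hn.2.2 (show s(p, q) ∈ _ by simp [triEdges]))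
      rw [List.nil_append, listEdges_append_pair]
      simp
    | cons w C =>
      -- The first path detours through `z` to `q` and runs the segment backwards to `w`; the second
      -- takes `wp`, `pq` and the rest.
      refine ⟨A ++ p :: z :: q :: (w :: C).reverse, w :: p :: q :: D, ?_, ?_, ?_⟩
      · simp [List.nodup_append] at hl ⊢
        grind
      · simp [List.nodup_append] at hl ⊢
        grind
      · have h1 : listEdges (q :: (w :: C).reverse) = listEdges (w :: (C ++ [q])) := by
          rw [← listEdges_reverse]; simp
        have h2 : listEdges (A ++ p :: (w :: C ++ q :: D)) =
            listEdges (A ++ [p]) + {s(p, w)} + listEdges (w :: (C ++ [q])) +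
              listEdges (q :: D) := by
          rw [listEdges_append_cons A, show listEdges (p :: (w :: C ++ q :: D)) =
            {s(p, w)} + listEdges (w :: C ++ q :: D) from (Multiset.singleton_add _ _).symm,
            listEdges_append_cons (w :: C), List.cons_append]
          abel
        rw [h2, listEdges_append_pair, listEdges_cons_cons z q, h1]
        simp only [listEdges_cons_cons, ← Multiset.singleton_add, triEdges,
          Sym2.eq_swap (a := w) (b := p), Sym2.eq_swap (a := z)]
        abel
  · push Not at hB
    refine ⟨A ++ [p, y], y :: z :: p :: B, ?_, ?_, ?_⟩
    · simp [List.nodup_append] at hl ⊢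
      grind
    · simp [List.nodup_append] at hl ⊢
      grind
    · rw [listEdges_append_cons, listEdges_append_pair]
      simp only [listEdges_cons_cons, listEdges_singleton, ← Multiset.singleton_add, triEdges]
      abel

/-- Two triangles that meet in a vertex, but in no edge, form two paths. -/
theorem exists_paths_of_triEdges_add_triEdges {x y z p q : V} (hxy : x ≠ y)
    (hyz : y ≠ z) (hzx : z ≠ x) (hxp : x ≠ p) (hpq : p ≠ q) (hqx : q ≠ x)
    (hn : (triEdges x y z + triEdges x p q).Nodup) :
    ∃ l₁ l₂ : List V, l₁.Nodup ∧ l₂.Nodup ∧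
      triEdges x y z + triEdges x p q = listEdges l₁ + listEdges l₂ := by
  have hd := (Multiset.nodup_add.1 hn).2.2
  have h1 : s(x, y) ∉ triEdges x p q := Multiset.disjoint_left.1 hd (by simp [triEdges])
  have h2 : s(z, x) ∉ triEdges x p q := Multiset.disjoint_left.1 hd (by simp [triEdges])
  simp only [triEdges, Multiset.mem_add, Multiset.mem_singleton, Sym2.eq_iff] at h1 h2
  -- Having no common edge at `x`, the triangles share no other corner.
  refine ⟨[y, z, x, p, q], [y, x, q], by simp; grind, by simp; grind, ?_⟩
  simp only [listEdges_cons_cons, listEdges_singleton, ← Multiset.singleton_add, triEdges,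
    Sym2.eq_swap (a := y) (b := x), Sym2.eq_swap (a := q) (b := x)]
  abel

/-! ### The induction -/

variable [DecidableEq V]

theorem TwoDegenerateOn.exists_third_neighbor {W : Finset V} {E : Multiset (Sym2 V)} {v : V}
    (hv : ¬ {u ∈ W | s(v, u) ∈ E}.card ≤ 2) (p q : V) : ∃ y, s(v, y) ∈ E ∧ y ≠ p ∧ y ≠ q := by
  by_contra! hcon
  refine hv ((Finset.card_le_card (t := {p, q}) fun u hu => ?_).trans Finset.card_le_two)
  have := hcon u (Finset.mem_filter.1 hu).2
  simp only [Finset.mem_insert, Finset.mem_singleton]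
  tauto

theorem TwoDegenerateOn.exists_dec_of_decBelow {W : Finset V} {E : Multiset (Sym2 V)}
    (h : TwoDegenerateOn W E) (ih : DecBelow W E) : ∃ t, Dec E (W.card / 2) t := by
  rcases E.empty_or_exists_mem with rfl | ⟨e, he⟩
  · exact ⟨0, Dec.zero.mono (Nat.zero_le _)⟩
  by_cases hadj : ∃ v w, s(v, w) ∈ E ∧ {u ∈ W | s(v, u) ∈ E}.card ≤ 2 ∧
      {u ∈ W | s(w, u) ∈ E}.card ≤ 2
  · obtain ⟨v, w, hvw, hv, hw⟩ := hadj
    exact h.exists_dec_of_adj ih hvw hv hw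
  have hlow {v w : V} (hvw : s(v, w) ∈ E) (hv : {u ∈ W | s(v, u) ∈ E}.card ≤ 2) :
      ¬ {u ∈ W | s(w, u) ∈ E}.card ≤ 2 := fun hw => hadj ⟨v, w, hvw, hv, hw⟩
  have hswap {v w : V} (hvw : s(v, w) ∈ E) : s(w, v) ∈ E := Sym2.eq_swap ▸ hvw
  set U : Finset V := {v ∈ W | ¬ {u ∈ W | s(v, u) ∈ E}.card ≤ 2} with hU
  have hUne : U.Nonempty := by
    induction e with | _ x y
    by_cases hx : {u ∈ W | s(x, u) ∈ E}.card ≤ 2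
    · exact ⟨y, Finset.mem_filter.2 ⟨h.mem (hswap he), hlow he hx⟩⟩
    · exact ⟨x, Finset.mem_filter.2 ⟨h.mem he, hx⟩⟩
  -- `z` has at least three neighbors but at most two in `U`, hence one of degree at most 2.
  obtain ⟨z, hzU, hzc⟩ := h.degenerate U hUne
  have hz3 := (Finset.mem_filter.1 hzU).2
  obtain ⟨v, hv, hzv⟩ : ∃ v, {u ∈ W | s(v, u) ∈ E}.card ≤ 2 ∧ s(z, v) ∈ E := by
    by_contra! hcon
    refine hz3 ((Finset.card_le_card fun u hu => ?_).trans hzc)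
    rw [Finset.mem_filter] at hu ⊢
    exact ⟨Finset.mem_filter.2 ⟨hu.1, fun hc => hcon u hc hu.2⟩, hu.2⟩
  by_cases hw : ∃ w, w ≠ v ∧ {u ∈ W | s(w, u) ∈ E}.card ≤ 2 ∧ s(z, w) ∈ E
  · obtain ⟨w, hwv, hw, hzw⟩ := hw
    obtain ⟨y, hzy, hyv, hyw⟩ := exists_third_neighbor hz3 v w
    exact h.exists_dec_of_common_neighbor ih hwv.symm (fun hvw => hlow hvw hv hw) hzv hzw hzy hyv
      hyw hv hw
  have hsub : {u ∈ W | s(z, u) ∈ E} ⊆ insert v {u ∈ U | s(z, u) ∈ E} := fun u hu => by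
    rw [Finset.mem_filter] at hu
    rw [Finset.mem_insert, Finset.mem_filter]
    refine or_iff_not_imp_left.2 fun huv => ⟨Finset.mem_filter.2 ⟨hu.1, fun hc => ?_⟩, hu.2⟩
    exact hw ⟨u, huv, hc, hu.2⟩
  have hcard : {u ∈ U | s(z, u) ∈ E}.card = 2 := by
    have h1 := Finset.card_le_card hsub
    have h2 := Finset.card_insert_le v {u ∈ U | s(z, u) ∈ E}
    omega
  obtain ⟨a, b, hab, hset⟩ := Finset.card_eq_two.1 hcard
  have hmem (u : V) : u ∈ ({a, b} : Finset V) → ¬ {x ∈ W | s(u, x) ∈ E}.card ≤ 2 ∧ s(z, u) ∈ E := by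
    rw [← hset, Finset.mem_filter]
    exact fun hu => ⟨(Finset.mem_filter.1 hu.1).2, hu.2⟩
  obtain ⟨ha, hza⟩ := hmem a (by simp)
  obtain ⟨hb, hzb⟩ := hmem b (by simp)
  have hz (u : V) (hu : s(z, u) ∈ E) : u = a ∨ u = b ∨ u = v := by
    have := hsub (Finset.mem_filter.2 ⟨h.mem (hswap hu), hu⟩)
    rw [hset] at this
    simp at this
    tauto
  have hav : a ≠ v := by rintro rfl; exact ha hv
  have hbv : b ≠ v := by rintro rfl; exact hb hv
  have haz := (h.ne hza).symm
  have hbz := (h.ne hzb).symm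
  have hvz := (h.ne hzv).symm
  rcases h.exists_tail (hswap hzv) hv with hvn | ⟨c, hcz, hcv, hvc, hvn⟩
  · rcases Nat.even_or_odd (deg a E) with hpar | hpar
    · exact h.exists_dec_of_even ih (b := b) (l := []) hza hzv hpar hz (by simp; grind)
        (by simp; grind) (by simp; grind) (by simp; grind)
    · exact h.exists_dec_of_odd ih hza hzb hzv hab hav hbv hpar hz (fun hvb => hbz (hvn b hvb))
        (c := z) (fun u hu => Or.inl (hvn u hu))
  by_cases hcb : c = b
  · subst hcb
    obtain ⟨y, hby, hyz, hyv⟩ := exists_third_neighbor hb z v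
    exact h.exists_dec_of_triangle ih hza hzb hzv hvc hby hab hav hyz hyv hz hvn
  by_cases hca : c = a
  · subst hca
    obtain ⟨y, hay, hyz, hyv⟩ := exists_third_neighbor ha z v
    exact h.exists_dec_of_triangle ih hzb hza hzv hvc hay hab.symm hbv hyz hyv
      (fun u hu => by have := hz u hu; tauto) hvn
  -- Now `c` differs from `a` and `b`, so `b z v c` is a path avoiding `a`.
  rcases Nat.even_or_odd (deg a E) with hpar | hpar
  · exact h.exists_dec_of_even ih (b := b) (l := [c]) hza hzv hpar hz (by simp; grind)
      (by simp; grind) (by simp; grind) (by simp; grind)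
  · exact h.exists_dec_of_odd ih hza hzb hzv hab hav hbv hpar hz
      (fun hvb => (hvn b hvb).elim hbz (Ne.symm hcb)) hvn

theorem TwoDegenerateOn.exists_dec {W : Finset V} {E : Multiset (Sym2 V)}
    (h : TwoDegenerateOn W E) : ∃ t, Dec E (W.card / 2) t := by
  induction hn : W.card + E.card using Nat.strong_induction_on generalizing W E with
  | _ n ih =>
    subst hn
    exact h.exists_dec_of_decBelow fun W' E' h' hlt => ih _ hlt h' rfl

end

/-! ### Back to graphs: walks, removal of triangles, degeneracy -/

section

variable {V : Type*}

theorem exists_isPath {G : SimpleGraph V} {l : List V} {a : V} (hl : (a :: l).Nodup)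
    (hG : ∀ e ∈ listEdges (a :: l), e ∈ G.edgeSet) :
    ∃ (b : V) (p : G.Walk a b), p.support = a :: l ∧ (p.edges : Multiset (Sym2 V)) =
      listEdges (a :: l) ∧ p.length = l.length := by
  induction l generalizing a with
  | nil => exact ⟨a, .nil, by simp, by simp, by simp⟩
  | cons c l ih =>
    have hac : G.Adj a c := hG s(a, c) (by simp)
    obtain ⟨b, p, h1, h2, h3⟩ := ih (List.nodup_cons.1 hl).2
      fun e he => hG e (by rw [listEdges_cons_cons]; exact Multiset.mem_cons_of_mem he)
    exact ⟨b, .cons hac p, by simp [h1], by simp [← h2], by simp [h3]⟩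

theorem Dec.exists_finset {G : SimpleGraph V} {E : Multiset (Sym2 V)} {k t : ℕ} (h : Dec E k t)
    (ht : t = 0) (hE : E.Nodup) (hG : ∀ e ∈ E, e ∈ G.edgeSet) :
    ∃ D : Finset (Set (Sym2 V)), D.card ≤ k ∧
      (∀ s ∈ D, ∃ (u v : V) (p : G.Walk u v), p.IsPath ∧ 0 < p.length ∧ p.edgeSet = s) ∧
      (D : Set (Set (Sym2 V))).PairwiseDisjoint id ∧
      ⋃₀ (D : Set (Set (Sym2 V))) = {e | e ∈ E} := by
  classical
  induction h with
  | zero => exact ⟨∅, by simp⟩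
  | @path E k t l hl h ih =>
    obtain ⟨hn1, hn2, hd⟩ := Multiset.nodup_add.1 hE
    obtain ⟨D, h1, h2, h3, h4⟩ := ih ht hn2 fun e he => hG e (Multiset.mem_add.2 (Or.inr he))
    match l, hl with
    -- Edgeless paths are dropped, since every part must be nonempty.
    | [], _ => exact ⟨D, by omega, h2, h3, by simpa using h4⟩
    | [a], _ => exact ⟨D, by omega, h2, h3, by simpa using h4⟩
    | a :: b :: l, hl =>
      obtain ⟨c, p, h5, h6, h7⟩ := exists_isPath hl
        fun e he => hG e (Multiset.mem_add.2 (Or.inl he))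
      have hset : p.edgeSet = {e | e ∈ listEdges (a :: b :: l)} := by
        ext e
        rw [← h6]
        simp [Walk.edgeSet]
      refine ⟨insert p.edgeSet D, (Finset.card_insert_le _ _).trans (by omega), ?_, ?_, ?_⟩
      · intro s hs
        rcases Finset.mem_insert.1 hs with rfl | hs
        · exact ⟨a, c, p, by rw [Walk.isPath_def, h5]; exact hl, by rw [h7]; simp, rfl⟩
        · exact h2 s hs
      · rw [Finset.coe_insert]
        refine h3.insert fun s hs _ => ?_
        rw [id, id, hset, Set.disjoint_left]
        intro e he hes
        have : e ∈ ⋃₀ (D : Set (Set (Sym2 V))) := ⟨s, hs, hes⟩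
        rw [h4] at this
        exact Multiset.disjoint_left.1 hd he this
      · rw [Finset.coe_insert, Set.sUnion_insert, h4, hset]
        ext e
        simp [or_assoc]
  | tri => simp at ht

/-- In a connected graph other than a triangle, triangles can be merged into paths. -/
theorem Dec.exists_fewer_triangles [Fintype V] {G : SimpleGraph V} (hconn : G.Connected)
    (htri : ¬ Nonempty (G ≃g (⊤ : SimpleGraph (Fin 3)))) {E : Multiset (Sym2 V)} (hE : E.Nodup)
    (hG : ∀ e, e ∈ E ↔ e ∈ G.edgeSet) {k t : ℕ} (h : Dec E k (t + 1)) :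
    ∃ s ≤ t, Dec E k s := by
  classical
  obtain ⟨x, y, z, F, j, hxy, hyz, hzx, rfl, rfl, hd⟩ := h.exists_tri
  have hadj {u v : V} (huv : s(u, v) ∈ triEdges x y z) : G.Adj u v :=
    (hG _).1 (Multiset.mem_add.2 (Or.inl huv))
  have axy : G.Adj x y := hadj (by simp [triEdges])
  have ayz : G.Adj y z := hadj (by simp [triEdges])
  have azx : G.Adj z x := hadj (by simp [triEdges])
  -- Some edge leaves the triangle, as otherwise connectivity would make the triangle all of `G`.
  -- The element containing that edge meets the triangle at `u`.
  obtain ⟨u, v, huv, hu, hv⟩ : ∃ u v, G.Adj u v ∧ (u = x ∨ u = y ∨ u = z) ∧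
      ¬ (v = x ∨ v = y ∨ v = z) := by
    by_contra hcon
    have hstep {u v : V} (huv : G.Adj u v) (hu : u = x ∨ u = y ∨ u = z) :
        v = x ∨ v = y ∨ v = z := by_contra fun hv => hcon ⟨u, v, huv, hu, hv⟩
    have hwalk {a b : V} (p : G.Walk a b) :
        (a = x ∨ a = y ∨ a = z) → b = x ∨ b = y ∨ b = z := by
      induction p with
      | nil => exact id
      | cons hab _ ih => exact fun ha => ih (hstep hab ha)
    have hall (w : V) : w = x ∨ w = y ∨ w = z :=
      hwalk (hconn.preconnected x w).some (Or.inl rfl)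
    have hcard : Fintype.card V = 3 :=
      Finset.card_eq_three.2 ⟨x, y, z, hxy, hzx.symm, hyz, by ext w; simpa using hall w⟩
    have htop : G = ⊤ := by
      ext u v
      rw [top_adj]
      refine ⟨Adj.ne, fun huv => ?_⟩
      rcases hall u with rfl | rfl | rfl <;> rcases hall v with rfl | rfl | rfl <;>
        first
        | exact absurd rfl huv
        | assumption
        | exact Adj.symm ‹_›
    subst htop
    exact htri ⟨Iso.completeGraph (Fintype.equivFinOfCardEq hcard)⟩
  have huvT : s(u, v) ∉ triEdges x y z := by
    simp only [triEdges, Multiset.mem_add, Multiset.mem_singleton, Sym2.eq_iff]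
    tauto
  have huvF : s(u, v) ∈ F := (Multiset.mem_add.1 ((hG _).2 huv)).resolve_left huvT
  rcases hd.exists_element huvF with
    ⟨l, F, i, h1, h2, rfl, rfl, h3⟩ | ⟨a, b, c, F, i, s, h1, h2, h3, h4, rfl, rfl, rfl, h5⟩
  · rw [← add_assoc] at hE ⊢
    obtain ⟨l₁, l₂, h4, h5, h6⟩ := exists_paths_of_triEdges_add_listEdges hxy hyz hzx h1
      (Multiset.nodup_add.1 hE).1 ⟨u, mem_of_mem_listEdges h2 (by simp), hu⟩
    exact ⟨t, le_rfl, (h3.path l₂ h5).path_of_eq h4 (by rw [h6, add_assoc])⟩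
  · obtain ⟨w, h6, h7, h8, h9⟩ := exists_triEdges_eq h1 h2 h3 h4
    rw [← add_assoc, h6] at hE ⊢
    have hE' := (Multiset.nodup_add.1 hE).1
    obtain ⟨l₁, l₂, h10, h11, h12⟩ : ∃ l₁ l₂ : List V, l₁.Nodup ∧ l₂.Nodup ∧
        triEdges x y z + triEdges u v w = listEdges l₁ + listEdges l₂ := by
      have hrot := triEdges_rotate x y z
      rcases hu with rfl | rfl | rfl
      · exact exists_paths_of_triEdges_add_triEdges hxy hyz hzx h7 h8 h9 hE'
      · rw [hrot] at hE' ⊢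
        exact exists_paths_of_triEdges_add_triEdges hyz hzx hxy h7 h8 h9 hE'
      · rw [hrot, triEdges_rotate] at hE' ⊢
        exact exists_paths_of_triEdges_add_triEdges hzx hxy hyz h7 h8 h9 hE'
    exact ⟨s, Nat.le_succ s, (h5.path l₂ h11).path_of_eq h10 (by rw [h12, add_assoc])⟩

theorem Dec.exists_no_triangle [Fintype V] {G : SimpleGraph V} (hconn : G.Connected)
    (htri : ¬ Nonempty (G ≃g (⊤ : SimpleGraph (Fin 3)))) {E : Multiset (Sym2 V)} (hE : E.Nodup)
    (hG : ∀ e, e ∈ E ↔ e ∈ G.edgeSet) {k t : ℕ} (h : Dec E k t) : Dec E k 0 := by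
  induction t using Nat.strong_induction_on with
  | _ t ih =>
    cases t with
    | zero => exact h
    | succ t =>
      obtain ⟨s, hs, h'⟩ := h.exists_fewer_triangles hconn htri hE hG
      exact ih s (Nat.lt_succ_of_le hs) h'

theorem exists_card_filter_adj_le {G : SimpleGraph V} {k : ℕ} (hdeg : G.IsDegenerate k)
    {U : Finset V} (hU : U.Nonempty) [DecidableRel G.Adj] :
    ∃ v ∈ U, {u ∈ U | G.Adj v u}.card ≤ k := by
  obtain ⟨v, hv, hvc⟩ := hdeg ((⊤ : G.Subgraph).induce U) hU
  refine ⟨v, hv, ?_⟩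
  have hset : ((⊤ : G.Subgraph).induce U).neighborSet v = {u ∈ U | G.Adj v u} := by
    ext u
    have hv' : v ∈ U := hv
    simp [Subgraph.mem_neighborSet, hv']
  rw [hset, Set.encard_coe_eq_coe_finsetCard] at hvc
  exact_mod_cast hvc

theorem twoDegenerateOn_univ [Fintype V] [DecidableEq V] {G : SimpleGraph V}
    [DecidableRel G.Adj] (hdeg : G.IsDegenerate 2) :
    TwoDegenerateOn Finset.univ G.edgeFinset.val := by
  have hmem (u v : V) : s(u, v) ∈ G.edgeFinset.val ↔ G.Adj u v := by
    rw [Finset.mem_val, mem_edgeFinset, mem_edgeSet]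
  refine ⟨G.edgeFinset.nodup, fun u v huv => ((hmem u v).1 huv).ne, fun _ _ _ => Finset.mem_univ _,
    fun U hU => ?_⟩
  simp only [hmem]
  exact exists_card_filter_adj_le hdeg hU

end

end SimpleGraph.PathDecomposition

theorem theorem1 {V : Type*} [Fintype V] (G : SimpleGraph V)
    (hconn : G.Connected) (hdeg : G.IsDegenerate 2)
    (htri : ¬ Nonempty (G ≃g (⊤ : SimpleGraph (Fin 3)))) :
    ∃ D : Finset (Set (Sym2 V)), G.IsPathDecomposition D ∧ D.card ≤ Fintype.card V / 2 := by
  classical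
  have hmem (e : Sym2 V) : e ∈ G.edgeFinset.val ↔ e ∈ G.edgeSet := by
    rw [Finset.mem_val, SimpleGraph.mem_edgeFinset]
  obtain ⟨t, ht⟩ := (SimpleGraph.PathDecomposition.twoDegenerateOn_univ hdeg).exists_dec
  obtain ⟨D, h1, h2, h3, h4⟩ :=
    (ht.exists_no_triangle hconn htri G.edgeFinset.nodup hmem).exists_finset rfl
      G.edgeFinset.nodup fun e he => (hmem e).1 he
  refine ⟨D, ⟨h2, h3, ?_⟩, h1⟩
  rw [h4]
  ext e
  exact hmem e
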